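/- Let $R_1,\dots,R_n$ be a database schema, i.e. a sequence of pairwise disjoint sets of attributes, where all attributes share one infinite domain $V$ of values. A relation over $R_i$ is a non-empty (finite or infinite) set of tuples $t\colon R_i\to V$, and a database is a sequence $d=(r_1,\dots,r_n)$ with $r_i$ a relation over $R_i$. Dependencies are interpreted as follows. * For finite $X,Y\subseteq R_i$, the functional dependency (FD) $R_i\colon X\to Y$ holds in $d$ if all $t,t'\in r_i$ with $t(X)=t'(X)$ satisfy $t(Y)=t'(Y)$. It is unary (a UFD) if $|X|\le 1$ and $|Y|\le 1$. * For finite $X,Y\subseteq R_i$ (not necessarily disjoint), the independence atom (IA) $R_i\colon X\perp Y$ holds in $d$ if for all $t,t'\in r_i$ there is $t''\in r_i$ with $t''(X)=t(X)$ and $t''(Y)=t'(Y)$. * For sequences $X=(A_1,\dots,A_k)$ in $R_i$ and $Y=(B_1,\dots,B_k)$ in $R_j$ of distinct attributes, the inclusion dependency (IND) $R_i[X]\subseteq R_j[Y]$ holds in $d$ if for every $t\in r_i$ there is $t'\in r_j$ with $t(A_m)=t'(B_m)$ for all $m$. It is unary (a UIND) if $k=1$. Let UFD+UIND+IA be the class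 of all UFDs, UINDs and IAs over the schema. For a finite set $\Sigma\cup\{\sigma\}$ of dependencies, write $\Sigma\models\sigma$ (unrestricted implication) if every database that satisfies $\Sigma$ satisfies $\sigma$. Consider the following rules, where juxtaposition of sets denotes union. * The rules $\mathfrak A^*$ (within one relation schema): trivial independence $\Rightarrow\emptyset\perp X$; symmetry $X\perp Y\Rightarrow Y\perp X$; decomposition $X\perp YZ\Rightarrow X\perp Y$; exchange $X\perp Y,\ XY\perp Z\Rightarrow X\perp YZ$; reflexivity $\Rightarrow XY\to Y$; transitivity $X\to Y,\ Y\to Z\Rightarrow X\to Z$; constancy $X\perp Y,\ X\to Y\Rightarrow\emptyset\to Y$; composition $X\perp YZ,\ Z\to W\Rightarrow X\perp YZW$. * $\mathcal U1$: $\Rightarrow R[X]\subseteq R[X]$. $\mathcal U2$: $R[X]\subseteq R'[Y],\ R'[Y]\subseteq R''[Z]\Rightarrow R[X]\subseteq R''[Z]$. * $\mathcal{UI}3$: $R[X]\subseteq R'[Y],\ R'\colon Y\perp Y\Rightarrow R'[Y]\subseteq R[X]$. $\mathcal{UI}4$: $R[X]\subseteq R'[Y],\ R'\colon Y\perp Y\Rightarrow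 R\colon X\perp X$. A deduction from $\Sigma$ is a finite sequence of FDs, INDs and IAs each of which belongs to $\Sigma$ or follows from earlier members by one of these rules; write $\Sigma\vdash\sigma$ if some deduction from $\Sigma$ ends in $\sigma$. Theorem. The axiomatization $\mathfrak A^*\cup\{\mathcal U1,\mathcal U2,\mathcal{UI}3,\mathcal{UI}4\}$ is sound and complete for the unrestricted implication problem of UFD+UIND+IA: for every finite set $\Sigma\cup\{\sigma\}$ of dependencies from UFD+UIND+IA, $$\Sigma\vdash\sigma\iff\Sigma\models\sigma .$$ Moreover the axiomatization is attribute-bounded: if $\Sigma\models\sigma$, then $\sigma$ has a deduction from $\Sigma$ that consists of dependencies from UFD+UIND+IA and in which only attributes from $\Sigma$ or $\sigma$ appear. -/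

import Mathlib

namespace RelDep

universe u v

variable {n : ℕ}

/-- Dependencies over a database schema `R_0, …, R_{n-1}`.  The attributes of `R_i` are the elements
of the type `α i`, so distinct relation schemata are disjoint. -/
inductive Dep (α : Fin n → Type u) : Type u
  /-- the functional dependency `R_i : X → Y` -/
  | fd (i : Fin n) (X Y : Finset (α i)) : Dep α
  /-- the independence atom `R_i : X ⊥ Y` (`X` and `Y` need not be disjoint) -/
  | ia (i : Fin n) (X Y : Finset (α i)) : Dep α
  /-- the inclusion dependency `R_i[X] ⊆ R_j[Y]`, for sequences of distinct attributes of equal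
  length -/
  | ind (i j : Fin n) (k : ℕ) (X : Fin k ↪ α i) (Y : Fin k ↪ α j) : Dep α

/-- A database: a nonempty relation over every schema.  A tuple over `R_i` is a function
`α i → V`, where `V` is the common domain of values. -/
structure Database (α : Fin n → Type u) (V : Type v) where
  /-- the relation over `R_i` -/
  rel : ∀ i, Set (α i → V)
  /-- relations are nonempty -/
  rel_nonempty : ∀ i, (rel i).Nonempty

variable {α : Fin n → Type u}

/-- Satisfaction of a dependency in a database. -/
def Database.Sat {V : Type v} (d : Database α V) : Dep α → Prop
  | .fd i X Y => ∀ t ∈ d.rel i, ∀ t' ∈ d.rel i,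
      (∀ a ∈ X, t a = t' a) → ∀ a ∈ Y, t a = t' a
  | .ia i X Y => ∀ t ∈ d.rel i, ∀ t' ∈ d.rel i,
      ∃ t'' ∈ d.rel i, (∀ a ∈ X, t'' a = t a) ∧ ∀ a ∈ Y, t'' a = t' a
  | .ind i j k X Y => ∀ t ∈ d.rel i, ∃ t' ∈ d.rel j, ∀ m : Fin k, t (X m) = t' (Y m)

/-- Unrestricted implication: every (finite or infinite) database over the domain `V` that
satisfies `Γ` satisfies `σ`. -/
def Implies (V : Type v) (Γ : Set (Dep α)) (σ : Dep α) : Prop :=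
  ∀ d : Database α V, (∀ τ ∈ Γ, d.Sat τ) → d.Sat σ

/-- Unary FDs (both sides have at most one attribute, so `∅ → A` is included), unary INDs and
arbitrary IAs. -/
def UFD_UIND_IA (α : Fin n → Type u) : Set (Dep α) :=
  {σ | match σ with
    | .fd _ X Y => X.card ≤ 1 ∧ Y.card ≤ 1
    | .ia _ _ _ => True
    | .ind _ _ k _ _ => k = 1}

/-- The attributes that appear in a dependency. -/
def Dep.attrs : Dep α → Set (Σ i, α i)
  | .fd i X Y => {p | ∃ a, (a ∈ X ∨ a ∈ Y) ∧ p = ⟨i, a⟩}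
  | .ia i X Y => {p | ∃ a, (a ∈ X ∨ a ∈ Y) ∧ p = ⟨i, a⟩}
  | .ind i j _ X Y => {p | (∃ m, p = ⟨i, X m⟩) ∨ ∃ m, p = ⟨j, Y m⟩}

/-- A set of rules: `𝔯 [σ₁, …, σ_m] σ` says that `σ₁, …, σ_m ⇒ σ` is an instance of a rule. -/
abbrev Axiomatization (α : Fin n → Type u) := List (Dep α) → Dep α → Prop

/-- The axiomatization `𝔄*` for FDs and IAs. -/
inductive AStar [∀ i, DecidableEq (α i)] : Axiomatization α
  /-- trivial independence: `⇒ ∅ ⊥ X` -/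
  | trivialIndependence (i : Fin n) (X : Finset (α i)) :
      AStar [] (.ia i ∅ X)
  /-- symmetry: `X ⊥ Y ⇒ Y ⊥ X` -/
  | symmetry (i : Fin n) (X Y : Finset (α i)) :
      AStar [.ia i X Y] (.ia i Y X)
  /-- decomposition: `X ⊥ YZ ⇒ X ⊥ Y` -/
  | decomposition (i : Fin n) (X Y Z : Finset (α i)) :
      AStar [.ia i X (Y ∪ Z)] (.ia i X Y)
  /-- exchange: `X ⊥ Y, XY ⊥ Z ⇒ X ⊥ YZ` -/
  | exchange (i : Fin n) (X Y Z : Finset (α i)) :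
      AStar [.ia i X Y, .ia i (X ∪ Y) Z] (.ia i X (Y ∪ Z))
  /-- reflexivity: `⇒ XY → Y` -/
  | reflexivity (i : Fin n) (X Y : Finset (α i)) :
      AStar [] (.fd i (X ∪ Y) Y)
  /-- transitivity: `X → Y, Y → Z ⇒ X → Z` -/
  | transitivity (i : Fin n) (X Y Z : Finset (α i)) :
      AStar [.fd i X Y, .fd i Y Z] (.fd i X Z)
  /-- constancy: `X ⊥ Y, X → Y ⇒ ∅ → Y` -/
  | constancy (i : Fin n) (X Y : Finset (α i)) :
      AStar [.ia i X Y, .fd i X Y] (.fd i ∅ Y)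
  /-- composition: `X ⊥ YZ, Z → V ⇒ X ⊥ YZV` -/
  | composition (i : Fin n) (X Y Z W : Finset (α i)) :
      AStar [.ia i X (Y ∪ Z), .fd i Z W] (.ia i X (Y ∪ Z ∪ W))

/-- The rules `𝒰1`, `𝒰2` for INDs and `𝒰ℐ3`, `𝒰ℐ4` for INDs and IAs.  In `Y ⊥ Y` the sequence `Y`
is read as the set of its members. -/
inductive InclRules : Axiomatization α
  /-- reflexivity: `⇒ R[X] ⊆ R[X]` -/
  | U1 (i : Fin n) (k : ℕ) (X : Fin k ↪ α i) :
      InclRules [] (.ind i i k X X)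
  /-- transitivity: `R[X] ⊆ R'[Y], R'[Y] ⊆ R''[Z] ⇒ R[X] ⊆ R''[Z]` -/
  | U2 (i j l : Fin n) (k : ℕ) (X : Fin k ↪ α i) (Y : Fin k ↪ α j) (Z : Fin k ↪ α l) :
      InclRules [.ind i j k X Y, .ind j l k Y Z] (.ind i l k X Z)
  /-- symmetry: `R[X] ⊆ R'[Y], R' : Y ⊥ Y ⇒ R'[Y] ⊆ R[X]` -/
  | UI3 (i j : Fin n) (k : ℕ) (X : Fin k ↪ α i) (Y : Fin k ↪ α j) :
      InclRules [.ind i j k X Y, .ia j (Finset.univ.map Y) (Finset.univ.map Y)]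
        (.ind j i k Y X)
  /-- constancy: `R[X] ⊆ R'[Y], R' : Y ⊥ Y ⇒ R : X ⊥ X` -/
  | UI4 (i j : Fin n) (k : ℕ) (X : Fin k ↪ α i) (Y : Fin k ↪ α j) :
      InclRules [.ind i j k X Y, .ia j (Finset.univ.map Y) (Finset.univ.map Y)]
        (.ia i (Finset.univ.map X) (Finset.univ.map X))

/-- The axiomatization `𝔄* ∪ {𝒰1, 𝒰2, 𝒰ℐ3, 𝒰ℐ4}`. -/
def unrestrictedAxioms [∀ i, DecidableEq (α i)] : Axiomatization α :=
  fun ps σ => AStar ps σ ∨ InclRules ps σ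

/-- `l` is a deduction from `Γ` by `𝔯`: each member of the sequence `l` is in `Γ` or follows from
earlier members by an application of a rule. -/
def IsDeduction (𝔯 : Axiomatization α) (Γ : Set (Dep α)) (l : List (Dep α)) : Prop :=
  ∀ (k : ℕ) (hk : k < l.length),
    l[k] ∈ Γ ∨ ∃ ps : List (Dep α), 𝔯 ps l[k] ∧ ∀ p ∈ ps, p ∈ l.take k

/-- `Γ ⊢ σ`: there is a deduction from `Γ` whose last member is `σ`. -/
def Derives (𝔯 : Axiomatization α) (Γ : Set (Dep α)) (σ : Dep α) : Prop :=
  ∃ l : List (Dep α), IsDeduction 𝔯 Γ l ∧ l.getLast? = some σ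

/-- Soundness for the unrestricted implication problem of the class `C`. -/
def Sound (V : Type v) (𝔯 : Axiomatization α) (C : Set (Dep α)) : Prop :=
  ∀ (Γ : Set (Dep α)) (σ : Dep α), Γ.Finite → Γ ⊆ C → σ ∈ C →
    Derives 𝔯 Γ σ → Implies V Γ σ

/-- Completeness for the unrestricted implication problem of the class `C`. -/
def Complete (V : Type v) (𝔯 : Axiomatization α) (C : Set (Dep α)) : Prop :=
  ∀ (Γ : Set (Dep α)) (σ : Dep α), Γ.Finite → Γ ⊆ C → σ ∈ C →
    Implies V Γ σ → Derives 𝔯 Γ σ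

/-- Every implication within the class `C` is verified by a deduction that consists of
dependencies from `C` and in which only attributes from `Γ` or `σ` appear. -/
def AttributeBounded (V : Type v) (𝔯 : Axiomatization α) (C : Set (Dep α)) : Prop :=
  ∀ (Γ : Set (Dep α)) (σ : Dep α), Γ.Finite → Γ ⊆ C → σ ∈ C → Implies V Γ σ →
    ∃ l : List (Dep α), IsDeduction 𝔯 Γ l ∧ l.getLast? = some σ ∧
      ∀ τ ∈ l, τ ∈ C ∧ τ.attrs ⊆ σ.attrs ∪ ⋃ ρ ∈ Γ, ρ.attrs

end RelDep

/-!
Soundness is checked rule by rule.  For completeness, let `𝒜` be the finite set of attributes that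
occur in `Γ` and `σ`, and let `D` be the set of dependencies that have a deduction from `Γ` within the
class and over `𝒜`.  Given `σ ∉ D`, a database that satisfies `D` and violates `σ` is built as
follows (`IsTheory.exists_database`).

* Functional dependencies and independence atoms compare values within one column only, so each
  column may be renamed by an injection without affecting them.  If the nonconstant columns are
  countably infinite, a column `E` can be renamed to have any prescribed countably infinite set of
  values, and a constant column any prescribed value.  Prescribing sets `W_E` with `W_A ⊆ W_B` iff
  `A ⊆ B` is in `D` takes care of the inclusion dependencies (`IsTheory.exists_columns`).  The rules
  `𝒰ℐ3` and `𝒰ℐ4` say exactly that such sets exist with `W_E` a singleton for the constant `E`.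
* Within one schema, give every nonconstant attribute `F` an integer `z F` and let the value of `E`
  be the family of all `z F` with `E → F` in `D`.  Then all functional dependencies of `D` hold
  whichever `z` are allowed, and the independence atoms of `D` hold if all `z` are allowed: if
  `X ⊥ Y` is in `D`, only constants can be determined by both `X` and `Y` (`IsTheory.const_of_determined`,
  `IsTheory.exists_combined`).  This violates every unary functional dependency over `𝒜` outside `D`.
* To violate an independence atom outside `D`, take a minimal `X ⊥ Y` below it that is not in `D`.
  If `X` and `Y` share an attribute, which is then not constant, it is already violated.  Otherwise
  allow only those `z` whose values on `P = X ∪ Y` sum to `0`.  An atom `A ⊥ B` of `D` can only fail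
  if `P` is covered by the attributes determined by `A` and those determined by `B`, but by neither
  of the two; the exchange rule and minimality would then put `X ⊥ Y` into `D`
  (`IsTheory.admissible_union`).
-/

namespace RelDep

universe u v

variable {n : ℕ} {α : Fin n → Type u}

/-! ### Soundness -/

theorem sat_of_rule [∀ i, DecidableEq (α i)] {V : Type v} (d : Database α V) {ps : List (Dep α)}
    {σ : Dep α} (h : unrestrictedAxioms ps σ) (hps : ∀ p ∈ ps, d.Sat p) : d.Sat σ := by
  rcases h with h | h
  · cases h with
    | trivialIndependence i X => exact fun t _ t' ht' => ⟨t', ht', by simp, by simp⟩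
    | symmetry i X Y =>
      intro t ht t' ht'
      obtain ⟨s, hs, h1, h2⟩ := hps (.ia i X Y) (by simp) t' ht' t ht
      exact ⟨s, hs, h2, h1⟩
    | decomposition i X Y Z =>
      intro t ht t' ht'
      obtain ⟨s, hs, h1, h2⟩ := hps (.ia i X (Y ∪ Z)) (by simp) t ht t' ht'
      exact ⟨s, hs, h1, fun a ha => h2 a (Finset.mem_union_left _ ha)⟩
    | exchange i X Y Z =>
      intro t ht t' ht'
      obtain ⟨s, hs, h1, h2⟩ := hps (.ia i X Y) (by simp) t ht t' ht'
      obtain ⟨r, hr, h3, h4⟩ := hps (.ia i (X ∪ Y) Z) (by simp) s hs t' ht'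
      refine ⟨r, hr, fun a ha => ?_, fun a ha => ?_⟩
      · rw [h3 a (Finset.mem_union_left _ ha), h1 a ha]
      · rcases Finset.mem_union.1 ha with ha | ha
        · rw [h3 a (Finset.mem_union_right _ ha), h2 a ha]
        · exact h4 a ha
    | reflexivity i X Y => exact fun t _ t' _ h a ha => h a (Finset.mem_union_right _ ha)
    | transitivity i X Y Z =>
      exact fun t ht t' ht' h => hps (.fd i Y Z) (by simp) t ht t' ht'
        (hps (.fd i X Y) (by simp) t ht t' ht' h)
    | constancy i X Y =>
      intro t ht t' ht' _ a ha
      obtain ⟨s, hs, h1, h2⟩ := hps (.ia i X Y) (by simp) t ht t' ht'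
      rw [← h2 a ha, hps (.fd i X Y) (by simp) s hs t ht h1 a ha]
    | composition i X Y Z W =>
      intro t ht t' ht'
      obtain ⟨s, hs, h1, h2⟩ := hps (.ia i X (Y ∪ Z)) (by simp) t ht t' ht'
      refine ⟨s, hs, h1, fun a ha => ?_⟩
      rcases Finset.mem_union.1 ha with ha | ha
      · exact h2 a ha
      · exact hps (.fd i Z W) (by simp) s hs t' ht'
          (fun b hb => h2 b (Finset.mem_union_right _ hb)) a ha
  · cases h with
    | U1 i k X => exact fun t ht => ⟨t, ht, fun _ => rfl⟩
    | U2 i j l k X Y Z =>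
      intro t ht
      obtain ⟨s, hs, h1⟩ := hps (.ind i j k X Y) (by simp) t ht
      obtain ⟨r, hr, h2⟩ := hps (.ind j l k Y Z) (by simp) s hs
      exact ⟨r, hr, fun m => (h1 m).trans (h2 m)⟩
    | UI3 i j k X Y =>
      intro t ht
      obtain ⟨s, hs⟩ := d.rel_nonempty i
      obtain ⟨r, hr, h1⟩ := hps (.ind i j k X Y) (by simp) s hs
      obtain ⟨q, _, h2, h3⟩ := hps (.ia j (Finset.univ.map Y) (Finset.univ.map Y)) (by simp)
        t ht r hr
      refine ⟨s, hs, fun m => ?_⟩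
      rw [h1 m, ← h2 (Y m) (by simp), h3 (Y m) (by simp)]
    | UI4 i j k X Y =>
      intro t ht t' ht'
      obtain ⟨r, hr, h1⟩ := hps (.ind i j k X Y) (by simp) t ht
      obtain ⟨r', hr', h1'⟩ := hps (.ind i j k X Y) (by simp) t' ht'
      obtain ⟨q, _, h2, h3⟩ := hps (.ia j (Finset.univ.map Y) (Finset.univ.map Y)) (by simp)
        r hr r' hr'
      refine ⟨t, ht, fun _ _ => rfl, fun a ha => ?_⟩
      obtain ⟨m, _, rfl⟩ := Finset.mem_map.1 ha
      rw [h1 m, h1' m, ← h2 (Y m) (by simp), h3 (Y m) (by simp)]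

theorem sound_unrestrictedAxioms [∀ i, DecidableEq (α i)] (V : Type v) (C : Set (Dep α)) :
    Sound V (unrestrictedAxioms (α := α)) C := by
  rintro Γ σ - - - ⟨l, hl, hlast⟩ d hd
  have key : ∀ (k : ℕ) (hk : k < l.length), d.Sat l[k] := by
    intro k
    induction k using Nat.strong_induction_on with
    | _ k ih =>
      intro hk
      rcases hl k hk with h | ⟨ps, hr, hps⟩
      · exact hd _ h
      · refine sat_of_rule d hr fun p hp => ?_
        obtain ⟨m, hm, rfl⟩ := List.mem_take_iff_getElem.1 (hps p hp)
        exact ih m (by omega) _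
  obtain ⟨k, hk, rfl⟩ := List.getElem_of_mem (List.mem_of_getLast? hlast)
  exact key k hk

/-! ### Deductions all of whose members satisfy a given condition -/

/-- `σ` is the last member of a deduction from `Γ` all of whose members lie in `Q`. -/
def DerivesWithin (𝔯 : Axiomatization α) (Γ Q : Set (Dep α)) (σ : Dep α) : Prop :=
  ∃ l : List (Dep α), IsDeduction 𝔯 Γ l ∧ l.getLast? = some σ ∧ ∀ τ ∈ l, τ ∈ Q

theorem IsDeduction.append {𝔯 : Axiomatization α} {Γ : Set (Dep α)} {l l' : List (Dep α)}
    (h : IsDeduction 𝔯 Γ l) (h' : IsDeduction 𝔯 Γ l') : IsDeduction 𝔯 Γ (l ++ l') := by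
  intro k hk
  rcases lt_or_ge k l.length with hkl | hkl
  · rw [List.getElem_append_left hkl]
    refine (h k hkl).imp_right fun ⟨ps, hr, hps⟩ => ⟨ps, hr, fun p hp => ?_⟩
    rw [List.take_append]
    exact List.mem_append_left _ (hps p hp)
  · rw [List.getElem_append_right hkl]
    refine (h' _ _).imp_right fun ⟨ps, hr, hps⟩ => ⟨ps, hr, fun p hp => ?_⟩
    rw [List.take_append]
    exact List.mem_append_right _ (hps p hp)

theorem IsDeduction.concat {𝔯 : Axiomatization α} {Γ : Set (Dep α)} {l : List (Dep α)}
    (h : IsDeduction 𝔯 Γ l) {σ : Dep α}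
    (hσ : σ ∈ Γ ∨ ∃ ps : List (Dep α), 𝔯 ps σ ∧ ∀ p ∈ ps, p ∈ l) :
    IsDeduction 𝔯 Γ (l ++ [σ]) := by
  intro k hk
  rcases lt_or_ge k l.length with hkl | hkl
  · rw [List.getElem_append_left hkl]
    refine (h k hkl).imp_right fun ⟨ps, hr, hps⟩ => ⟨ps, hr, fun p hp => ?_⟩
    rw [List.take_append]
    exact List.mem_append_left _ (hps p hp)
  · obtain rfl : k = l.length := by simp at hk; omega
    simpa using hσ

theorem DerivesWithin.of_rule {𝔯 : Axiomatization α} {Γ Q : Set (Dep α)} {ps : List (Dep α)}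
    {σ : Dep α} (hr : 𝔯 ps σ) (hps : ∀ p ∈ ps, DerivesWithin 𝔯 Γ Q p) (hσ : σ ∈ Q) :
    DerivesWithin 𝔯 Γ Q σ := by
  have key : ∃ l : List (Dep α), IsDeduction 𝔯 Γ l ∧ (∀ p ∈ ps, p ∈ l) ∧ ∀ τ ∈ l, τ ∈ Q := by
    clear hr
    induction ps with
    | nil => exact ⟨[], fun k hk => absurd hk (by simp), by simp, by simp⟩
    | cons p ps ih =>
      obtain ⟨l, hl, hm, hQ⟩ := ih fun q hq => hps q (List.mem_cons_of_mem _ hq)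
      obtain ⟨l', hl', hm', hQ'⟩ := hps p (by simp)
      refine ⟨l ++ l', hl.append hl', fun q hq => ?_, fun τ hτ => ?_⟩
      · rcases List.mem_cons.1 hq with rfl | hq
        · exact List.mem_append_right _ (List.mem_of_getLast? hm')
        · exact List.mem_append_left _ (hm q hq)
      · exact (List.mem_append.1 hτ).elim (hQ τ) (hQ' τ)
  obtain ⟨l, hl, hm, hQ⟩ := key
  refine ⟨l ++ [σ], hl.concat (Or.inr ⟨ps, hr, hm⟩), by simp, fun τ hτ => ?_⟩
  rcases List.mem_append.1 hτ with h | h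
  · exact hQ τ h
  · rwa [List.mem_singleton.1 h]

theorem DerivesWithin.of_mem {𝔯 : Axiomatization α} {Γ Q : Set (Dep α)} {σ : Dep α} (h : σ ∈ Γ)
    (hσ : σ ∈ Q) : DerivesWithin 𝔯 Γ Q σ := by
  have h0 : IsDeduction 𝔯 Γ [] := fun k hk => absurd hk (by simp)
  exact ⟨[σ], h0.concat (Or.inl h), by simp, by simpa using hσ⟩

/-! ### Theories -/

/-- The dependencies of the class all of whose attributes lie in `𝒜`. -/
def classWithin (𝒜 : Set (Σ i, α i)) : Set (Dep α) :=
  {τ | τ ∈ UFD_UIND_IA α ∧ τ.attrs ⊆ 𝒜}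

/-- `D` is a set of dependencies of the class over the attributes `𝒜` that is closed under those
instances of the rules whose conclusion is of the class and over `𝒜`. -/
structure IsTheory [∀ i, DecidableEq (α i)] (D : Set (Dep α)) (𝒜 : Set (Σ i, α i)) : Prop where
  sub : D ⊆ classWithin 𝒜
  closed : ∀ (ps : List (Dep α)) (τ : Dep α), unrestrictedAxioms ps τ → (∀ p ∈ ps, p ∈ D) →
    τ ∈ classWithin 𝒜 → τ ∈ D

theorem fd_mem_classWithin {𝒜 : Set (Σ i, α i)} {i : Fin n} {X Y : Finset (α i)} :
    Dep.fd i X Y ∈ classWithin 𝒜 ↔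
      (X.card ≤ 1 ∧ Y.card ≤ 1) ∧ (∀ a ∈ X, ⟨i, a⟩ ∈ 𝒜) ∧ ∀ a ∈ Y, ⟨i, a⟩ ∈ 𝒜 := by
  refine and_congr Iff.rfl ⟨fun h => ⟨fun a ha => h ⟨a, Or.inl ha, rfl⟩,
    fun a ha => h ⟨a, Or.inr ha, rfl⟩⟩, ?_⟩
  rintro ⟨h1, h2⟩ _ ⟨a, ha, rfl⟩
  exact ha.elim (h1 a) (h2 a)

theorem ia_mem_classWithin {𝒜 : Set (Σ i, α i)} {i : Fin n} {X Y : Finset (α i)} :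
    Dep.ia i X Y ∈ classWithin 𝒜 ↔ (∀ a ∈ X, ⟨i, a⟩ ∈ 𝒜) ∧ ∀ a ∈ Y, ⟨i, a⟩ ∈ 𝒜 := by
  refine ⟨fun h => ⟨fun a ha => h.2 ⟨a, Or.inl ha, rfl⟩, fun a ha => h.2 ⟨a, Or.inr ha, rfl⟩⟩, ?_⟩
  rintro ⟨h1, h2⟩
  refine ⟨trivial, ?_⟩
  rintro _ ⟨a, ha, rfl⟩
  exact ha.elim (h1 a) (h2 a)

/-- The sequence of length one with member `a`. -/
def single {β : Type u} (a : β) : Fin 1 ↪ β :=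
  ⟨fun _ => a, Function.injective_of_subsingleton _⟩

/-- The unary inclusion dependency between two attributes. -/
def uind (p q : Σ i, α i) : Dep α :=
  .ind p.1 q.1 1 (single p.2) (single q.2)

theorem ind_one_eq_uind {i j : Fin n} (X : Fin 1 ↪ α i) (Y : Fin 1 ↪ α j) :
    Dep.ind i j 1 X Y = uind ⟨i, X 0⟩ ⟨j, Y 0⟩ := by
  have h : ∀ {β : Type u} (Z : Fin 1 ↪ β), Z = single (Z 0) := by
    intro β Z
    ext m
    rw [Subsingleton.elim m 0]
    rfl
  unfold uind
  rw [← h X, ← h Y]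

theorem uind_mem_classWithin {𝒜 : Set (Σ i, α i)} {p q : Σ i, α i} :
    uind p q ∈ classWithin 𝒜 ↔ p ∈ 𝒜 ∧ q ∈ 𝒜 := by
  refine ⟨fun h => ⟨h.2 (Or.inl ⟨0, rfl⟩), h.2 (Or.inr ⟨0, rfl⟩)⟩, ?_⟩
  rintro ⟨h1, h2⟩
  refine ⟨rfl, ?_⟩
  rintro _ (⟨_, rfl⟩ | ⟨_, rfl⟩)
  exacts [h1, h2]

theorem map_single {β : Type u} (a : β) : Finset.univ.map (single a) = {a} := by
  ext b
  simp [single, eq_comm]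

theorem eq_singleton_of_card_le_one {β : Type u} {X : Finset β} {a : β} (h : X.card ≤ 1)
    (ha : a ∈ X) : X = {a} :=
  Finset.eq_singleton_iff_unique_mem.2 ⟨ha, fun b hb => Finset.card_le_one.1 h b hb a ha⟩

/-- The attributes determined, according to `D`, by a single attribute of `X`. -/
def determined (D : Set (Dep α)) (i : Fin n) (X : Finset (α i)) : Set (α i) :=
  {F | ∃ E ∈ X, Dep.fd i {E} {F} ∈ D}

namespace IsTheory

variable [∀ i, DecidableEq (α i)] {D : Set (Dep α)} {𝒜 : Set (Σ i, α i)} {i : Fin n}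

theorem fd_refl (T : IsTheory D 𝒜) {X Y : Finset (α i)} (hX : X.card ≤ 1)
    (hX' : ∀ a ∈ X, ⟨i, a⟩ ∈ 𝒜) (h : Y ⊆ X) : Dep.fd i X Y ∈ D := by
  have := T.closed [] _ (Or.inl (AStar.reflexivity i X Y)) (by simp)
  rw [Finset.union_eq_left.2 h] at this
  exact this (fd_mem_classWithin.2
    ⟨⟨hX, (Finset.card_le_card h).trans hX⟩, hX', fun a ha => hX' a (h ha)⟩)

theorem fd_refl_single (T : IsTheory D 𝒜) {E : α i} (hE : ⟨i, E⟩ ∈ 𝒜) :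
    Dep.fd i {E} {E} ∈ D :=
  T.fd_refl (by simp) (by simpa using hE) subset_rfl

theorem fd_trans (T : IsTheory D 𝒜) {X Y Z : Finset (α i)} (h : Dep.fd i X Y ∈ D)
    (h' : Dep.fd i Y Z ∈ D) : Dep.fd i X Z ∈ D := by
  refine T.closed _ _ (Or.inl (AStar.transitivity i X Y Z)) (by simp [h, h']) ?_
  have h1 := fd_mem_classWithin.1 (T.sub h)
  have h2 := fd_mem_classWithin.1 (T.sub h')
  exact fd_mem_classWithin.2 ⟨⟨h1.1.1, h2.1.2⟩, h1.2.1, h2.2.2⟩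

theorem fd_of_const (T : IsTheory D 𝒜) {X Y : Finset (α i)} (hX : X.card ≤ 1)
    (hX' : ∀ a ∈ X, ⟨i, a⟩ ∈ 𝒜) (h : Dep.fd i ∅ Y ∈ D) : Dep.fd i X Y ∈ D :=
  T.fd_trans (T.fd_refl hX hX' (Finset.empty_subset _)) h

theorem mem_left (T : IsTheory D 𝒜) {E F : α i} (h : Dep.fd i {E} {F} ∈ D) : ⟨i, E⟩ ∈ 𝒜 :=
  (fd_mem_classWithin.1 (T.sub h)).2.1 E (by simp)

theorem mem_right (T : IsTheory D 𝒜) {X : Finset (α i)} {F : α i} (h : Dep.fd i X {F} ∈ D) :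
    ⟨i, F⟩ ∈ 𝒜 :=
  (fd_mem_classWithin.1 (T.sub h)).2.2 F (by simp)

theorem ia_empty (T : IsTheory D 𝒜) {X : Finset (α i)} (hX : ∀ a ∈ X, ⟨i, a⟩ ∈ 𝒜) :
    Dep.ia i ∅ X ∈ D :=
  T.closed [] _ (Or.inl (AStar.trivialIndependence i X)) (by simp)
    (ia_mem_classWithin.2 ⟨by simp, hX⟩)

theorem ia_symm (T : IsTheory D 𝒜) {X Y : Finset (α i)} (h : Dep.ia i X Y ∈ D) :
    Dep.ia i Y X ∈ D :=
  T.closed _ _ (Or.inl (AStar.symmetry i X Y)) (by simp [h])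
    (ia_mem_classWithin.2 (ia_mem_classWithin.1 (T.sub h)).symm)

theorem ia_mono_right (T : IsTheory D 𝒜) {X Y Y' : Finset (α i)} (h : Dep.ia i X Y ∈ D)
    (hY : Y' ⊆ Y) : Dep.ia i X Y' ∈ D := by
  have h1 := ia_mem_classWithin.1 (T.sub h)
  refine T.closed _ _ (Or.inl (AStar.decomposition i X Y' Y)) ?_
    (ia_mem_classWithin.2 ⟨h1.1, fun a ha => h1.2 a (hY ha)⟩)
  rw [Finset.union_eq_right.2 hY]
  simpa using h

theorem ia_exchange (T : IsTheory D 𝒜) {X Y Z : Finset (α i)} (h : Dep.ia i X Y ∈ D)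
    (h' : Dep.ia i (X ∪ Y) Z ∈ D) : Dep.ia i X (Y ∪ Z) ∈ D := by
  have h1 := ia_mem_classWithin.1 (T.sub h)
  have h2 := ia_mem_classWithin.1 (T.sub h')
  refine T.closed _ _ (Or.inl (AStar.exchange i X Y Z)) (by simp [h, h'])
    (ia_mem_classWithin.2 ⟨h1.1, fun a ha => ?_⟩)
  exact (Finset.mem_union.1 ha).elim (h1.2 a) (h2.2 a)

theorem ia_composition (T : IsTheory D 𝒜) {X Y Z W : Finset (α i)} (h : Dep.ia i X Y ∈ D)
    (hZ : Z ⊆ Y) (h' : Dep.fd i Z W ∈ D) : Dep.ia i X (Y ∪ W) ∈ D := by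
  have h1 := ia_mem_classWithin.1 (T.sub h)
  have h2 := fd_mem_classWithin.1 (T.sub h')
  have h3 := T.closed _ _ (Or.inl (AStar.composition i X Y Z W))
  rw [Finset.union_eq_left.2 hZ] at h3
  exact h3 (by simp [h, h']) (ia_mem_classWithin.2
    ⟨h1.1, fun a ha => (Finset.mem_union.1 ha).elim (h1.2 a) (h2.2.2 a)⟩)

theorem ia_insert_const (T : IsTheory D 𝒜) {X Y : Finset (α i)} {F : α i}
    (h : Dep.ia i X Y ∈ D) (hF : Dep.fd i ∅ {F} ∈ D) : Dep.ia i X (insert F Y) ∈ D := by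
  rw [Finset.insert_eq, Finset.union_comm]
  exact T.ia_composition h (Finset.empty_subset _) hF

theorem ia_self_of_const (T : IsTheory D 𝒜) {F : α i} (hF : Dep.fd i ∅ {F} ∈ D) :
    Dep.ia i {F} {F} ∈ D :=
  T.ia_insert_const (T.ia_symm (T.ia_empty (X := {F}) (by simpa using T.mem_right hF))) hF

theorem const_of_ia (T : IsTheory D 𝒜) {E F : α i} (h : Dep.ia i {E} {F} ∈ D)
    (h' : Dep.fd i {E} {F} ∈ D) : Dep.fd i ∅ {F} ∈ D := by
  refine T.closed _ _ (Or.inl (AStar.constancy i {E} {F})) (by simp [h, h']) ?_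
  have h1 := fd_mem_classWithin.1 (T.sub h')
  exact fd_mem_classWithin.2 ⟨⟨by simp, h1.1.2⟩, by simp, h1.2.2⟩

/-- Independence passes from `Y` to any set of attributes determined by `Y`. -/
theorem ia_determined_right (T : IsTheory D 𝒜) {X Y Y' : Finset (α i)} (h : Dep.ia i X Y ∈ D)
    (hY : ∀ F ∈ Y', F ∈ determined D i Y) : Dep.ia i X Y' ∈ D := by
  suffices h' : Dep.ia i X (Y ∪ Y') ∈ D from T.ia_mono_right h' Finset.subset_union_right
  induction Y' using Finset.induction_on with
  | empty => simpa using h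
  | insert F Y' _ ih =>
    obtain ⟨E, hE, hF⟩ := hY F (by simp)
    have h1 := T.ia_composition (ih fun G hG => hY G (Finset.mem_insert_of_mem hG))
      (Finset.singleton_subset_iff.2 (Finset.mem_union_left _ hE)) hF
    rwa [Finset.union_assoc, Finset.union_comm Y', ← Finset.insert_eq] at h1

theorem ia_determined (T : IsTheory D 𝒜) {X X' Y Y' : Finset (α i)} (h : Dep.ia i X Y ∈ D)
    (hX : ∀ F ∈ X', F ∈ determined D i X) (hY : ∀ F ∈ Y', F ∈ determined D i Y) :
    Dep.ia i X' Y' ∈ D :=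
  T.ia_symm (T.ia_determined_right (T.ia_symm (T.ia_determined_right h hY)) hX)

/-- Independent sets of attributes jointly determine only constants. -/
theorem const_of_determined (T : IsTheory D 𝒜) {X Y : Finset (α i)} (h : Dep.ia i X Y ∈ D)
    {F : α i} (hX : F ∈ determined D i X) (hY : F ∈ determined D i Y) : Dep.fd i ∅ {F} ∈ D := by
  refine T.const_of_ia (E := F) (T.ia_determined h (by simpa using hX) (by simpa using hY)) ?_
  obtain ⟨E, -, hE⟩ := hX
  exact T.fd_refl_single (T.mem_right hE)

theorem uind_refl (T : IsTheory D 𝒜) {p : Σ i, α i} (hp : p ∈ 𝒜) : uind p p ∈ D :=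
  T.closed [] _ (Or.inr (InclRules.U1 _ _ _)) (by simp) (uind_mem_classWithin.2 ⟨hp, hp⟩)

theorem uind_trans (T : IsTheory D 𝒜) {p q r : Σ i, α i} (h : uind p q ∈ D) (h' : uind q r ∈ D) :
    uind p r ∈ D :=
  T.closed [uind p q, uind q r] _ (Or.inr (InclRules.U2 _ _ _ _ _ _ _)) (by simp [h, h'])
    (uind_mem_classWithin.2
      ⟨(uind_mem_classWithin.1 (T.sub h)).1, (uind_mem_classWithin.1 (T.sub h')).2⟩)

theorem uind_symm (T : IsTheory D 𝒜) {p q : Σ i, α i} (h : uind p q ∈ D)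
    (hq : Dep.fd q.1 ∅ {q.2} ∈ D) : uind q p ∈ D := by
  have h1 := T.closed _ (uind q p) (Or.inr (InclRules.UI3 p.1 q.1 1 (single p.2) (single q.2)))
  rw [map_single] at h1
  refine h1 ?_ (uind_mem_classWithin.2 (uind_mem_classWithin.1 (T.sub h)).symm)
  intro τ hτ
  rcases List.mem_cons.1 hτ with rfl | hτ
  · exact h
  · rw [List.mem_singleton.1 hτ]
    exact T.ia_self_of_const hq

theorem const_of_uind (T : IsTheory D 𝒜) {p q : Σ i, α i} (h : uind p q ∈ D)
    (hq : Dep.fd q.1 ∅ {q.2} ∈ D) : Dep.fd p.1 ∅ {p.2} ∈ D := by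
  have hp := (uind_mem_classWithin.1 (T.sub h)).1
  have h1 := T.closed _ _ (Or.inr (InclRules.UI4 p.1 q.1 1 (single p.2) (single q.2)))
  rw [map_single, map_single] at h1
  refine T.const_of_ia (h1 ?_ (ia_mem_classWithin.2 ⟨by simpa using hp, by simpa using hp⟩))
    (T.fd_refl_single hp)
  intro τ hτ
  rcases List.mem_cons.1 hτ with rfl | hτ
  · exact h
  · rw [List.mem_singleton.1 hτ]
    exact T.ia_self_of_const hq

end IsTheory

/-! ### The relation over one schema -/

open Classical in
/-- The value of the attribute `E`, before renaming: the family of the integers `z F` of the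
attributes `F` determined by `E`. -/
noncomputable def mask (D : Set (Dep α)) (i : Fin n) (E : α i) (z : α i → ℤ) : α i → ℤ :=
  fun F => if Dep.fd i {E} {F} ∈ D then z F else 0

theorem mask_apply {D : Set (Dep α)} {i : Fin n} {E F : α i} (h : Dep.fd i {E} {F} ∈ D)
    (z : α i → ℤ) : mask D i E z F = z F :=
  if_pos h

theorem mask_eq_mask_iff {D : Set (Dep α)} {i : Fin n} {E : α i} {z z' : α i → ℤ} :
    mask D i E z = mask D i E z' ↔ ∀ F, Dep.fd i {E} {F} ∈ D → z F = z' F := by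
  refine ⟨fun h F hF => ?_, fun h => funext fun F => ?_⟩
  · rw [← mask_apply hF z, h, mask_apply hF]
  · unfold mask
    split_ifs with hF
    exacts [h F hF, rfl]

/-- The families of integers that define the tuples over `R_i`: they vanish at the constants, and
their values on `P` sum to `0`. -/
def allowed (D : Set (Dep α)) (i : Fin n) (P : Finset (α i)) : Set (α i → ℤ) :=
  {z | (∀ F, Dep.fd i ∅ {F} ∈ D → z F = 0) ∧ ∑ F ∈ P, z F = 0}

theorem zero_mem_allowed (D : Set (Dep α)) (i : Fin n) (P : Finset (α i)) : 0 ∈ allowed D i P :=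
  ⟨fun _ _ => rfl, by simp⟩

/-- The values of the column `E` before renaming. -/
def values (D : Set (Dep α)) {i : Fin n} (P : Finset (α i)) (E : α i) : Set (α i → ℤ) :=
  mask D i E '' allowed D i P

/-- The conditions on `P` under which the families in `allowed D i P` yield a relation that
satisfies `D` and whose nonconstant columns are infinite. -/
structure Admissible (D : Set (Dep α)) (i : Fin n) (P : Finset (α i)) : Prop where
  not_const : ∀ F ∈ P, Dep.fd i ∅ {F} ∉ D
  card_ne_one : P.card ≠ 1
  split : ∀ X Y, Dep.ia i X Y ∈ D → (∀ F ∈ P, F ∈ determined D i X ∨ F ∈ determined D i Y) →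
    (∀ F ∈ P, F ∈ determined D i X) ∨ ∀ F ∈ P, F ∈ determined D i Y

theorem admissible_empty (D : Set (Dep α)) (i : Fin n) : Admissible D i ∅ :=
  ⟨by simp, by simp, by simp⟩

namespace IsTheory

variable [∀ i, DecidableEq (α i)] {D : Set (Dep α)} {𝒜 : Set (Σ i, α i)} {i : Fin n}

/-- The independence atoms of `D` hold in the relation defined by an admissible set. -/
theorem exists_combined (T : IsTheory D 𝒜) {P : Finset (α i)} (hP : Admissible D i P)
    {X Y : Finset (α i)} (h : Dep.ia i X Y ∈ D) {z z' : α i → ℤ} (hz : z ∈ allowed D i P)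
    (hz' : z' ∈ allowed D i P) :
    ∃ w ∈ allowed D i P, (∀ E ∈ X, mask D i E w = mask D i E z) ∧
      ∀ E ∈ Y, mask D i E w = mask D i E z' := by
  classical
  set b : α i → ℤ := fun F =>
    if F ∈ determined D i X then z F else if F ∈ determined D i Y then z' F else 0 with hb
  have hbX : ∀ F ∈ determined D i X, b F = z F := fun F hF => if_pos hF
  have hbY : ∀ F ∈ determined D i Y, b F = z' F := by
    intro F hF
    by_cases hFX : F ∈ determined D i X
    · have hc := T.const_of_determined h hFX hF
      rw [hbX F hFX, hz.1 F hc, hz'.1 F hc]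
    · simp [hb, hFX, hF]
  have hb0 : ∀ F, Dep.fd i ∅ {F} ∈ D → b F = 0 := by
    intro F hF
    simp only [hb]
    split_ifs
    exacts [hz.1 F hF, hz'.1 F hF, rfl]
  suffices hw : ∃ w ∈ allowed D i P,
      ∀ F, F ∈ determined D i X ∨ F ∈ determined D i Y → w F = b F by
    obtain ⟨w, hw, hwb⟩ := hw
    refine ⟨w, hw, fun E hE => mask_eq_mask_iff.2 fun F hF => ?_,
      fun E hE => mask_eq_mask_iff.2 fun F hF => ?_⟩
    · rw [hwb F (Or.inl ⟨E, hE, hF⟩), hbX F ⟨E, hE, hF⟩]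
    · rw [hwb F (Or.inr ⟨E, hE, hF⟩), hbY F ⟨E, hE, hF⟩]
  by_cases hcov : ∀ F ∈ P, F ∈ determined D i X ∨ F ∈ determined D i Y
  · refine ⟨b, ⟨hb0, ?_⟩, fun _ _ => rfl⟩
    rcases hP.split X Y h hcov with hPX | hPY
    · rw [Finset.sum_congr rfl fun F hF => hbX F (hPX F hF), hz.2]
    · rw [Finset.sum_congr rfl fun F hF => hbY F (hPY F hF), hz'.2]
  · -- an attribute of `P` outside both closures is free to correct the sum
    push Not at hcov
    obtain ⟨p, hpP, hpX, hpY⟩ := hcov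
    refine ⟨Function.update b p (-∑ F ∈ P.erase p, b F), ⟨fun F hF => ?_, ?_⟩, fun F hF => ?_⟩
    · rw [Function.update_of_ne, hb0 F hF]
      rintro rfl
      exact hP.not_const F hpP hF
    · rw [← Finset.add_sum_erase _ _ hpP, Function.update_self,
        Finset.sum_congr rfl fun F hF =>
          Function.update_of_ne (Finset.ne_of_mem_erase hF) _ b, neg_add_cancel]
    · rw [Function.update_of_ne]
      rintro rfl
      exact hF.elim hpX hpY

theorem values_countable (T : IsTheory D 𝒜) (h𝒜 : 𝒜.Finite) (P : Finset (α i)) (E : α i) :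
    (values D P E).Countable := by
  have hfin : {F : α i | Dep.fd i {E} {F} ∈ D}.Finite :=
    (h𝒜.preimage (sigma_mk_injective.injOn)).subset fun F hF => T.mem_right hF
  have := hfin.to_subtype
  refine Set.MapsTo.countable_of_injOn
    (f := fun s => fun F : {F : α i | Dep.fd i {E} {F} ∈ D} => s F)
    (t := Set.univ) (fun _ _ => trivial) ?_ (Set.to_countable _)
  rintro _ ⟨z, -, rfl⟩ _ ⟨z', -, rfl⟩ h
  refine mask_eq_mask_iff.2 fun F hF => ?_
  have := congrFun h ⟨F, hF⟩
  simpa only [mask_apply hF] using this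

theorem values_infinite (T : IsTheory D 𝒜) {P : Finset (α i)} (hP : Admissible D i P) {E : α i}
    (hE : ⟨i, E⟩ ∈ 𝒜) (hE' : Dep.fd i ∅ {E} ∉ D) : (values D P E).Infinite := by
  suffices h : ∀ k : ℤ, ∃ z ∈ allowed D i P, z E = k by
    choose z hz hzE using h
    refine Set.infinite_of_injective_forall_mem (f := fun k => mask D i E (z k)) ?_
      fun k => ⟨z k, hz k, rfl⟩
    intro k l hkl
    rw [← hzE k, ← hzE l]
    exact mask_eq_mask_iff.1 hkl E (T.fd_refl_single hE)
  intro k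
  have hsingle : ∀ {F G : α i} (c : ℤ), Dep.fd i ∅ {F} ∉ D → Dep.fd i ∅ {G} ∈ D →
      (Pi.single F c : α i → ℤ) G = 0 := by
    intro F G c hF hG
    refine Pi.single_eq_of_ne (M := fun _ => ℤ) ?_ c
    rintro rfl
    exact hF hG
  by_cases hEP : E ∈ P
  · obtain ⟨F, hF, hFE⟩ : ∃ F ∈ P, F ≠ E := by
      by_contra! hall
      exact hP.card_ne_one
        (Finset.card_eq_one.2 ⟨E, Finset.eq_singleton_iff_unique_mem.2 ⟨hEP, hall⟩⟩)
    refine ⟨Pi.single E k + Pi.single F (-k), ⟨fun G hG => ?_, ?_⟩, ?_⟩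
    · simp [hsingle _ hE' hG, hsingle _ (hP.not_const F hF) hG]
    · simp [Finset.sum_add_distrib, hEP, hF]
    · simp [hFE.symm]
  · refine ⟨Pi.single E k, ⟨fun G hG => hsingle k hE' hG, ?_⟩, by simp⟩
    simp [hEP]

theorem values_const (T : IsTheory D 𝒜) (P : Finset (α i)) {E : α i}
    (hE : Dep.fd i ∅ {E} ∈ D) : values D P E = {0} := by
  refine Set.eq_singleton_iff_unique_mem.2 ⟨⟨0, zero_mem_allowed D i P, ?_⟩, ?_⟩
  · funext F
    simp [mask]
  · rintro _ ⟨z, hz, rfl⟩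
    funext F
    unfold mask
    split_ifs with hF
    exacts [hz.1 F (T.fd_trans hE hF), rfl]

end IsTheory

/-! ### The columns of the database -/

theorem exists_bijOn_of_equiv {β : Type u} {V : Type v} [Nonempty V] {S : Set β}
    {W : Set V} (e : S ≃ W) : ∃ f : β → V, Set.BijOn f S W := by
  classical
  refine ⟨fun x => if h : x ∈ S then e ⟨x, h⟩ else Classical.arbitrary V, fun x hx => ?_,
    fun x hx y hy hxy => ?_, fun w hw => ⟨e.symm ⟨w, hw⟩, Subtype.prop _, ?_⟩⟩
  · simp [hx]
  · simpa only [dif_pos hx, dif_pos hy, Subtype.val_inj, e.injective.eq_iff, Subtype.mk.injEq]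
      using hxy
  · simp

namespace IsTheory

variable [∀ i, DecidableEq (α i)] {D : Set (Dep α)} {𝒜 : Set (Σ i, α i)} {i : Fin n}

/-- Column sets in an infinite domain whose inclusions are exactly the inclusion dependencies
of `D`. -/
theorem exists_columns (T : IsTheory D 𝒜) (h𝒜 : 𝒜.Finite) (V : Type v) [Infinite V] :
    ∃ W : (Σ i, α i) → Set V, (∀ p, (W p).Countable) ∧
      (∀ p ∈ 𝒜, Dep.fd p.1 ∅ {p.2} ∉ D → (W p).Infinite) ∧
      (∀ p, Dep.fd p.1 ∅ {p.2} ∈ D → ∃ v, W p = {v}) ∧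
      ∀ p ∈ 𝒜, ∀ q ∈ 𝒜, W p ⊆ W q ↔ uind p q ∈ D := by
  -- the values owned by an attribute are named by the set of attributes below it, so that
  -- constants with equal value share their name
  let down : (Σ i, α i) → Set (Σ i, α i) := fun p => {q | uind q p ∈ D}
  have hleft : ∀ {p q : Σ i, α i}, uind p q ∈ D → p ∈ 𝒜 := fun h =>
    (uind_mem_classWithin.1 (T.sub h)).1
  have hcount : ({s : Set (Σ i, α i) | s ⊆ 𝒜} ×ˢ (Set.univ : Set ℕ)).Countable :=
    h𝒜.finite_subsets.countable.prod (Set.to_countable _)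
  obtain ⟨g₀, hg₀⟩ := Set.countable_iff_exists_injOn.1 hcount
  let g : Set (Σ i, α i) × ℕ → V := fun x => Infinite.natEmbedding V (g₀ x)
  have hg : ∀ {p q k l}, g (down p, k) = g (down q, l) → down p = down q ∧ k = l := by
    intro p q k l h
    have := hg₀ ⟨fun r hr => hleft hr, trivial⟩ ⟨fun r hr => hleft hr, trivial⟩
      ((Infinite.natEmbedding V).injective h)
    simpa using this
  let W : (Σ i, α i) → Set V := fun p =>
    {v | ∃ q k, uind q p ∈ D ∧ (Dep.fd q.1 ∅ {q.2} ∈ D → k = 0) ∧ v = g (down q, k)}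
  refine ⟨W, fun p => ?_, fun p hp hc => ?_, fun p hc => ⟨g (down p, 0), ?_⟩,
    fun p hp q hq => ⟨fun h => ?_, ?_⟩⟩
  · refine (hcount.image g).mono ?_
    rintro _ ⟨q, k, -, -, rfl⟩
    exact ⟨_, ⟨fun r hr => hleft hr, trivial⟩, rfl⟩
  · refine Set.infinite_of_injective_forall_mem (f := fun k : ℕ => g (down p, k))
      (fun k l h => (hg h).2) fun k => ⟨p, k, T.uind_refl hp, fun h => absurd h hc, rfl⟩
  · refine Set.eq_singleton_iff_unique_mem.2
      ⟨⟨p, 0, T.uind_refl (T.mem_right hc), by simp, rfl⟩, ?_⟩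
    rintro _ ⟨q, k, hq, hk, rfl⟩
    have h1 : down q = down p := Set.ext fun r =>
      ⟨fun hr => T.uind_trans hr hq, fun hr => T.uind_trans hr (T.uind_symm hq hc)⟩
    rw [h1, hk (T.const_of_uind hq hc)]
  · obtain ⟨r, k, hr, -, h1⟩ := h ⟨p, 0, T.uind_refl hp, by simp, rfl⟩
    have h2 : p ∈ down r := (hg h1).1 ▸ T.uind_refl hp
    exact T.uind_trans h2 hr
  · rintro h _ ⟨r, k, hr, hk, rfl⟩
    exact ⟨r, k, T.uind_trans hr h, hk, rfl⟩

/-- Every choice of admissible sets, one for each schema, gives a model of `D` that satisfies no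
further unary inclusion dependency.  The tuples over `R_i` are those with values
`f i E (mask D i E z)`, and the renaming `f i E` is injective on the values that occur. -/
theorem exists_database (T : IsTheory D 𝒜) (h𝒜 : 𝒜.Finite) (V : Type v) [Infinite V]
    {P : ∀ i, Finset (α i)} (hP : ∀ i, Admissible D i (P i)) :
    ∃ (d : Database α V) (f : ∀ i, α i → (α i → ℤ) → V),
      (∀ i, d.rel i = (fun z E => f i E (mask D i E z)) '' allowed D i (P i)) ∧
      (∀ i E, ⟨i, E⟩ ∈ 𝒜 → Set.InjOn (f i E) (values D (P i) E)) ∧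
      (∀ τ ∈ D, d.Sat τ) ∧ ∀ p ∈ 𝒜, ∀ q ∈ 𝒜, d.Sat (uind p q) → uind p q ∈ D := by
  obtain ⟨W, hWc, hWi, hW1, hW⟩ := T.exists_columns h𝒜 V
  have hf : ∀ i (E : α i), ∃ f : (α i → ℤ) → V,
      ⟨i, E⟩ ∈ 𝒜 → Set.BijOn f (values D (P i) E) (W ⟨i, E⟩) := by
    intro i E
    by_cases hE : (⟨i, E⟩ : Σ i, α i) ∈ 𝒜
    · suffices h : Nonempty (values D (P i) E ≃ W ⟨i, E⟩) by
        obtain ⟨f, hf⟩ := exists_bijOn_of_equiv h.some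
        exact ⟨f, fun _ => hf⟩
      by_cases hc : Dep.fd i ∅ {E} ∈ D
      · obtain ⟨v, hv⟩ := hW1 ⟨i, E⟩ hc
        rw [hv, T.values_const (P i) hc]
        exact ⟨Equiv.ofUnique _ _⟩
      · have := (T.values_countable h𝒜 (P i) E).to_subtype
        have := (hWc ⟨i, E⟩).to_subtype
        have := (T.values_infinite (hP i) hE hc).to_subtype
        have := (hWi ⟨i, E⟩ hE hc).to_subtype
        exact nonempty_equiv_of_countable
    · exact ⟨fun _ => Classical.arbitrary V, fun h => absurd h hE⟩
  choose f hf using hf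
  let d : Database α V :=
    ⟨fun i => (fun z E => f i E (mask D i E z)) '' allowed D i (P i),
      fun i => ⟨_, 0, zero_mem_allowed D i (P i), rfl⟩⟩
  have huind : ∀ p ∈ 𝒜, ∀ q ∈ 𝒜, d.Sat (uind p q) ↔ uind p q ∈ D := by
    rintro ⟨i, A⟩ hA ⟨j, B⟩ hB
    rw [← hW _ hA _ hB]
    constructor
    · intro h v hv
      obtain ⟨_, ⟨z, hz, rfl⟩, rfl⟩ := (hf i A hA).surjOn hv
      obtain ⟨_, ⟨z', hz', rfl⟩, h'⟩ := h _ ⟨z, hz, rfl⟩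
      have h1 : f i A (mask D i A z) = f j B (mask D j B z') := h' 0
      rw [h1]
      exact (hf j B hB).mapsTo ⟨z', hz', rfl⟩
    · rintro h _ ⟨z, hz, rfl⟩
      obtain ⟨_, ⟨z', hz', rfl⟩, h'⟩ := (hf j B hB).surjOn (h ((hf i A hA).mapsTo ⟨z, hz, rfl⟩))
      exact ⟨_, ⟨z', hz', rfl⟩, fun _ => h'.symm⟩
  refine ⟨d, f, fun i => rfl, fun i E hE => (hf i E hE).injOn, fun τ hτ => ?_,
    fun p hp q hq => (huind p hp q hq).1⟩
  cases τ with
  | fd i X Y =>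
    rintro _ ⟨z, hz, rfl⟩ _ ⟨z', hz', rfl⟩ h B hB
    have hcl := fd_mem_classWithin.1 (T.sub hτ)
    obtain rfl : Y = {B} := eq_singleton_of_card_le_one hcl.1.2 hB
    suffices h' : mask D i B z = mask D i B z' from congrArg (f i B) h'
    rw [mask_eq_mask_iff]
    intro F hF
    have hXF := T.fd_trans hτ hF
    rcases X.eq_empty_or_nonempty with rfl | ⟨A, hA⟩
    · rw [hz.1 F hXF, hz'.1 F hXF]
    · obtain rfl : X = {A} := eq_singleton_of_card_le_one hcl.1.1 hA
      exact mask_eq_mask_iff.1 ((hf i A (T.mem_left hXF)).injOn ⟨z, hz, rfl⟩ ⟨z', hz', rfl⟩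
        (h A hA)) F hXF
  | ia i X Y =>
    rintro _ ⟨z, hz, rfl⟩ _ ⟨z', hz', rfl⟩
    obtain ⟨w, hw, hX, hY⟩ := T.exists_combined (hP i) hτ hz hz'
    exact ⟨_, ⟨w, hw, rfl⟩, fun E hE => congrArg (f i E) (hX E hE),
      fun E hE => congrArg (f i E) (hY E hE)⟩
  | ind i j k X Y =>
    obtain rfl : k = 1 := (T.sub hτ).1
    rw [ind_one_eq_uind] at hτ ⊢
    have hcl := uind_mem_classWithin.1 (T.sub hτ)
    exact (huind _ hcl.1 _ hcl.2).2 hτ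

/-! ### Violating the dependencies that are not derivable -/

theorem single_mem_allowed {E : α i} (hE : Dep.fd i ∅ {E} ∉ D) :
    Pi.single E 1 ∈ allowed D i ∅ :=
  ⟨fun F hF => Pi.single_eq_of_ne (by rintro rfl; exact hE hF) _, by simp⟩

theorem uind_mem_of_implies (T : IsTheory D 𝒜) (h𝒜 : 𝒜.Finite) (V : Type v) [Infinite V]
    {p q : Σ i, α i} (hp : p ∈ 𝒜) (hq : q ∈ 𝒜) (h : Implies V D (uind p q)) : uind p q ∈ D := by
  obtain ⟨d, f, -, -, hd, hu⟩ := T.exists_database h𝒜 V fun i => admissible_empty D i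
  exact hu p hp q hq (h d hd)

theorem fd_mem_of_implies (T : IsTheory D 𝒜) (h𝒜 : 𝒜.Finite) (V : Type v) [Infinite V]
    {X Y : Finset (α i)} (hσ : Dep.fd i X Y ∈ classWithin 𝒜) (h : Implies V D (.fd i X Y)) :
    Dep.fd i X Y ∈ D := by
  obtain ⟨⟨hX, hY⟩, hX𝒜, hY𝒜⟩ := fd_mem_classWithin.1 hσ
  rcases Y.eq_empty_or_nonempty with rfl | ⟨B, hB⟩
  · exact T.fd_refl hX hX𝒜 (Finset.empty_subset _)
  obtain rfl : Y = {B} := eq_singleton_of_card_le_one hY hB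
  by_contra hn
  have hBc : Dep.fd i ∅ {B} ∉ D := fun hc => hn (T.fd_of_const hX hX𝒜 hc)
  obtain ⟨d, f, hrel, hf, hd, -⟩ := T.exists_database h𝒜 V fun i => admissible_empty D i
  have hm : ∀ z ∈ allowed D i ∅, (fun E => f i E (mask D i E z)) ∈ d.rel i := by
    rw [hrel]
    exact fun z hz => ⟨z, hz, rfl⟩
  have h0 := zero_mem_allowed D i ∅
  have h1 := single_mem_allowed hBc
  have h2 := h d hd _ (hm _ h0) _ (hm _ h1) ?_ B hB
  · have h3 := mask_eq_mask_iff.1 (hf i B (hY𝒜 B hB) ⟨_, h0, rfl⟩ ⟨_, h1, rfl⟩ h2) B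
      (T.fd_refl_single (hY𝒜 B hB))
    simp at h3
  · intro A hA
    refine congrArg (f i A) (mask_eq_mask_iff.2 fun F hF => ?_)
    rw [Pi.single_eq_of_ne, Pi.zero_apply]
    rintro rfl
    refine hn (T.fd_trans (T.fd_refl hX hX𝒜 (Finset.singleton_subset_iff.2 hA)) hF)

/-- In a minimal pair of sets whose independence is not in `D`, no attribute is constant: it could
be added to the independence of the smaller pair. -/
theorem not_const_of_minimal (T : IsTheory D 𝒜) {X Y : Finset (α i)}
    (hmin : Minimal (fun p : Finset (α i) × Finset (α i) => Dep.ia i p.1 p.2 ∉ D) (X, Y)) {F : α i}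
    (hF : F ∈ X ∨ F ∈ Y) : Dep.fd i ∅ {F} ∉ D := by
  intro hc
  rcases hF with hF | hF
  · have h1 : Dep.ia i (X.erase F) Y ∈ D := by
      by_contra hn
      have := (hmin.2 (y := (X.erase F, Y)) hn ⟨Finset.erase_subset _ _, le_rfl⟩).1 hF
      simp at this
    have h2 := T.ia_insert_const (T.ia_symm h1) hc
    rw [Finset.insert_erase hF] at h2
    exact hmin.1 (T.ia_symm h2)
  · have h1 : Dep.ia i X (Y.erase F) ∈ D := by
      by_contra hn
      have := (hmin.2 (y := (X, Y.erase F)) hn ⟨le_rfl, Finset.erase_subset _ _⟩).2 hF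
      simp at this
    have h2 := T.ia_insert_const h1 hc
    rw [Finset.insert_erase hF] at h2
    exact hmin.1 h2

/-- The union of a minimal disjoint pair of sets whose independence is not in `D` is admissible.
The point is the splitting condition: if `A ⊥ B` is in `D` and properly splits `X ∪ Y`, two
applications of the exchange rule to smaller pairs give `X ⊥ Y`. -/
theorem admissible_union (T : IsTheory D 𝒜) {X Y : Finset (α i)}
    (hmin : Minimal (fun p : Finset (α i) × Finset (α i) => Dep.ia i p.1 p.2 ∉ D) (X, Y))
    (hX : X.Nonempty) (hY : Y.Nonempty) (hXY : Disjoint X Y) : Admissible D i (X ∪ Y) := by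
  classical
  refine ⟨fun F hF => T.not_const_of_minimal hmin (Finset.mem_union.1 hF), ?_, ?_⟩
  · rw [Finset.card_union_of_disjoint hXY]
    have := hX.card_pos
    have := hY.card_pos
    omega
  intro A B hAB hcov
  by_contra! hcon
  obtain ⟨⟨F, hF, hFA⟩, G, hG, hGB⟩ := hcon
  have hmin' : ∀ {X' Y' : Finset (α i)}, X' ⊆ X → Y' ⊆ Y → ∀ E ∈ X ∪ Y, E ∉ X' → E ∉ Y' →
      Dep.ia i X' Y' ∈ D := by
    intro X' Y' hX' hY' E hE hEX hEY
    by_contra hn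
    have := hmin.2 (y := (X', Y')) hn ⟨hX', hY'⟩
    exact (Finset.mem_union.1 hE).elim (fun h => hEX (this.1 h)) fun h => hEY (this.2 h)
  -- `X₁`, `Y₁` are the parts determined by `A`, and `X₂`, `Y₂` the rest
  set X₁ := X.filter (· ∈ determined D i A) with hX₁
  set X₂ := X.filter (· ∉ determined D i A) with hX₂
  set Y₁ := Y.filter (· ∈ determined D i A) with hY₁
  set Y₂ := Y.filter (· ∉ determined D i A) with hY₂
  have eX : X₁ ∪ X₂ = X := Finset.filter_union_filter_not_eq _ _
  have eY : Y₁ ∪ Y₂ = Y := Finset.filter_union_filter_not_eq _ _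
  have hsplit : Dep.ia i (X₁ ∪ Y₁) (X₂ ∪ Y₂) ∈ D := by
    refine T.ia_determined hAB (fun E hE => ?_) fun E hE => ?_
    · simp only [hX₁, hY₁, Finset.mem_union, Finset.mem_filter] at hE
      tauto
    · have := hcov E
      simp only [hX₂, hY₂, Finset.mem_union, Finset.mem_filter] at hE this
      tauto
  have hGA : G ∈ determined D i A := (hcov G hG).resolve_right hGB
  refine hmin.1 ?_
  have h11 : Dep.ia i X₁ Y₁ ∈ D := hmin' (Finset.filter_subset _ _) (Finset.filter_subset _ _) F hF
    (by simp [hX₁, hFA]) (by simp [hY₁, hFA])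
  rcases Finset.mem_union.1 hG with hGX | hGY
  · have h1 : Dep.ia i X₁ (Y ∪ X₂) ∈ D := by
      have := T.ia_exchange h11 hsplit
      rwa [Finset.union_comm X₂, ← Finset.union_assoc, eY] at this
    have h2 : Dep.ia i X₂ Y ∈ D := hmin' (Finset.filter_subset _ _) subset_rfl G hG
      (by simp [hX₂, hGA]) (Finset.disjoint_left.1 hXY hGX)
    have h3 := T.ia_exchange (T.ia_symm h2) (T.ia_symm h1)
    rw [Finset.union_comm X₂, eX] at h3
    exact T.ia_symm h3
  · have h1 : Dep.ia i Y₁ (X ∪ Y₂) ∈ D := by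
      have := T.ia_exchange (T.ia_symm h11) (by rwa [Finset.union_comm])
      rwa [← Finset.union_assoc, eX] at this
    have h2 : Dep.ia i X Y₂ ∈ D := hmin' subset_rfl (Finset.filter_subset _ _) G hG
      (Finset.disjoint_right.1 hXY hGY) (by simp [hY₂, hGA])
    have h3 := T.ia_exchange h2 (T.ia_symm h1)
    rwa [Finset.union_comm Y₂, eY] at h3

theorem ia_mem_of_implies (T : IsTheory D 𝒜) (h𝒜 : 𝒜.Finite) (V : Type v) [Infinite V]
    {X₀ Y₀ : Finset (α i)} (hσ : Dep.ia i X₀ Y₀ ∈ classWithin 𝒜)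
    (h : Implies V D (.ia i X₀ Y₀)) : Dep.ia i X₀ Y₀ ∈ D := by
  obtain ⟨hX₀, hY₀⟩ := ia_mem_classWithin.1 hσ
  by_contra hn
  obtain ⟨⟨X, Y⟩, ⟨hX, hY⟩, hmin⟩ := exists_minimal_le_of_wellFoundedLT
    (fun p : Finset (α i) × Finset (α i) => Dep.ia i p.1 p.2 ∉ D) (X₀, Y₀) hn
  replace hX : X ⊆ X₀ := hX
  replace hY : Y ⊆ Y₀ := hY
  have hX𝒜 : ∀ a ∈ X, (⟨i, a⟩ : Σ i, α i) ∈ 𝒜 := fun a ha => hX₀ a (hX ha)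
  have hY𝒜 : ∀ a ∈ Y, (⟨i, a⟩ : Σ i, α i) ∈ 𝒜 := fun a ha => hY₀ a (hY ha)
  by_cases hXY : Disjoint X Y
  · have hXn : X.Nonempty := by
      rw [Finset.nonempty_iff_ne_empty]
      rintro rfl
      exact hmin.1 (T.ia_empty hY𝒜)
    have hYn : Y.Nonempty := by
      rw [Finset.nonempty_iff_ne_empty]
      rintro rfl
      exact hmin.1 (T.ia_symm (T.ia_empty hX𝒜))
    have hadm : ∀ j, Admissible D j
        (Function.update (β := fun i => Finset (α i)) (fun _ => ∅) i (X ∪ Y) j) := by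
      intro j
      rcases eq_or_ne j i with rfl | hj
      · simpa using T.admissible_union hmin hXn hYn hXY
      · simpa [hj] using admissible_empty D j
    obtain ⟨d, f, hrel, hf, hd, -⟩ := T.exists_database h𝒜 V hadm
    replace hrel := hrel i
    replace hf := hf i
    rw [Function.update_self] at hrel hf
    obtain ⟨x, hx⟩ := hXn
    obtain ⟨y, hy⟩ := hYn
    have hxY : x ∉ Y := Finset.disjoint_left.1 hXY hx
    have hm : ∀ z ∈ allowed D i (X ∪ Y), (fun E => f i E (mask D i E z)) ∈ d.rel i := by
      rw [hrel]
      exact fun z hz => ⟨z, hz, rfl⟩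
    have h0 := zero_mem_allowed D i (X ∪ Y)
    have h1 : (Pi.single x 1 + Pi.single y (-1) : α i → ℤ) ∈ allowed D i (X ∪ Y) := by
      refine ⟨fun F hF => ?_, by simp [Finset.sum_add_distrib, hx, hy]⟩
      rw [Pi.add_apply, Pi.single_eq_of_ne, Pi.single_eq_of_ne, add_zero]
      · rintro rfl
        exact T.not_const_of_minimal hmin (Or.inr hy) hF
      · rintro rfl
        exact T.not_const_of_minimal hmin (Or.inl hx) hF
    obtain ⟨s, hs, hsX, hsY⟩ := h d hd _ (hm _ h0) _ (hm _ h1)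
    rw [hrel] at hs
    obtain ⟨w, hw, rfl⟩ := hs
    have hwX : ∀ E ∈ X, w E = 0 := fun E hE =>
      mask_eq_mask_iff.1 (hf E (hX𝒜 E hE) ⟨_, hw, rfl⟩ ⟨_, h0, rfl⟩ (hsX E (hX hE))) E
        (T.fd_refl_single (hX𝒜 E hE))
    have hwY : ∀ E ∈ Y, w E = (Pi.single y (-1) : α i → ℤ) E := by
      intro E hE
      rw [mask_eq_mask_iff.1 (hf E (hY𝒜 E hE) ⟨_, hw, rfl⟩ ⟨_, h1, rfl⟩ (hsY E (hY hE))) E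
        (T.fd_refl_single (hY𝒜 E hE)), Pi.add_apply, Pi.single_eq_of_ne, zero_add]
      rintro rfl
      exact hxY hE
    -- the values of `w` on `X ∪ Y` sum to `-1`
    have h2 := hw.2
    rw [Finset.sum_union hXY, Finset.sum_congr rfl hwX, Finset.sum_congr rfl hwY] at h2
    simp [hy] at h2
  · rw [Finset.not_disjoint_iff] at hXY
    obtain ⟨E, hEX, hEY⟩ := hXY
    obtain ⟨d, f, hrel, hf, hd, -⟩ := T.exists_database h𝒜 V fun i => admissible_empty D i
    have hm : ∀ z ∈ allowed D i ∅, (fun E => f i E (mask D i E z)) ∈ d.rel i := by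
      rw [hrel]
      exact fun z hz => ⟨z, hz, rfl⟩
    have h0 := zero_mem_allowed D i ∅
    have h1 := single_mem_allowed (T.not_const_of_minimal hmin (Or.inl hEX))
    obtain ⟨s, -, hsX, hsY⟩ := h d hd _ (hm _ h0) _ (hm _ h1)
    have h2 := (hsX E (hX hEX)).symm.trans (hsY E (hY hEY))
    have h3 := mask_eq_mask_iff.1 (hf i E (hX𝒜 E hEX) ⟨_, h0, rfl⟩ ⟨_, h1, rfl⟩ h2) E
      (T.fd_refl_single (hX𝒜 E hEX))
    simp at h3

theorem mem_of_implies (T : IsTheory D 𝒜) (h𝒜 : 𝒜.Finite) (V : Type v) [Infinite V] {σ : Dep α}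
    (hσ : σ ∈ classWithin 𝒜) (h : Implies V D σ) : σ ∈ D := by
  cases σ with
  | fd i X Y => exact T.fd_mem_of_implies h𝒜 V hσ h
  | ia i X Y => exact T.ia_mem_of_implies h𝒜 V hσ h
  | ind i j k X Y =>
    obtain rfl : k = 1 := hσ.1
    rw [ind_one_eq_uind] at hσ h ⊢
    obtain ⟨h1, h2⟩ := uind_mem_classWithin.1 hσ
    exact T.uind_mem_of_implies h𝒜 V h1 h2 h

end IsTheory

/-! ### Completeness -/

theorem Dep.finite_attrs (σ : Dep α) : σ.attrs.Finite := by
  have key : ∀ (i : Fin n) (X Y : Finset (α i)),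
      {p : Σ i, α i | ∃ a, (a ∈ X ∨ a ∈ Y) ∧ p = ⟨i, a⟩}.Finite := by
    intro i X Y
    refine ((X.finite_toSet.union Y.finite_toSet).image (Sigma.mk i)).subset ?_
    rintro _ ⟨a, ha, rfl⟩
    exact ⟨a, ha, rfl⟩
  cases σ with
  | fd i X Y => exact key i X Y
  | ia i X Y => exact key i X Y
  | ind i j k X Y =>
    refine ((Set.finite_range fun m => (⟨i, X m⟩ : Σ i, α i)).union
      (Set.finite_range fun m => (⟨j, Y m⟩ : Σ i, α i))).subset ?_
    rintro _ (⟨m, rfl⟩ | ⟨m, rfl⟩)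
    exacts [Or.inl ⟨m, rfl⟩, Or.inr ⟨m, rfl⟩]

theorem attributeBounded_unrestrictedAxioms [∀ i, DecidableEq (α i)] (V : Type v) [Infinite V] :
    AttributeBounded V (unrestrictedAxioms (α := α)) (UFD_UIND_IA α) := by
  intro Γ σ hΓ hΓC hσC h
  set 𝒜 : Set (Σ i, α i) := σ.attrs ∪ ⋃ ρ ∈ Γ, ρ.attrs with h𝒜
  have hfin : 𝒜.Finite := σ.finite_attrs.union (hΓ.biUnion fun ρ _ => ρ.finite_attrs)
  have T : IsTheory {τ | DerivesWithin (unrestrictedAxioms (α := α)) Γ (classWithin 𝒜) τ} 𝒜 :=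
    ⟨fun τ ⟨_, _, hlast, hQ⟩ => hQ τ (List.mem_of_getLast? hlast),
      fun _ _ hr hps hτ => DerivesWithin.of_rule hr hps hτ⟩
  refine T.mem_of_implies hfin V ⟨hσC, Set.subset_union_left⟩ fun d hd => h d fun τ hτ => ?_
  exact hd τ (DerivesWithin.of_mem hτ
    ⟨hΓC hτ, (Set.subset_biUnion_of_mem hτ).trans Set.subset_union_right⟩)

end RelDep

theorem mainTheorem2 {n : ℕ} (α : Fin n → Type*) [∀ i, DecidableEq (α i)]
    (V : Type*) [Infinite V] :
    RelDep.Sound V (RelDep.unrestrictedAxioms (α := α)) (RelDep.UFD_UIND_IA α) ∧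
      RelDep.Complete V (RelDep.unrestrictedAxioms (α := α)) (RelDep.UFD_UIND_IA α) ∧
      RelDep.AttributeBounded V (RelDep.unrestrictedAxioms (α := α)) (RelDep.UFD_UIND_IA α) := by
  have hbounded := RelDep.attributeBounded_unrestrictedAxioms (α := α) V
  refine ⟨RelDep.sound_unrestrictedAxioms V _, fun Γ σ hΓ hΓC hσC h => ?_, hbounded⟩
  obtain ⟨l, hl, hlast, -⟩ := hbounded Γ σ hΓ hΓC hσC h
  exact ⟨l, hl, hlast⟩
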